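/- A finite group $G$ with commutator subgroup $G' = [G,G]$ is called a Camina group if, for every $g \in G \setminus G'$, the conjugacy class of $g$ is the coset $gG'$. A Camina $p$-group is a Camina group that is also a $p$-group. For every odd prime $p$, there exists a (finite) Camina $p$-group $G$ of nilpotence class exactly $3$ such that $C_G(G') = G'$. -/

import Mathlib

open scoped Pointwise

/-- A group `G` is a Camina group if the conjugacy class of every `g ∈ G \ G'` is the coset `gG'`,
where `G'` is the commutator subgroup. (Finiteness is required separately.) -/
def IsCaminaGroup (G : Type*) [Group G] : Prop :=
  ∀ g : G, g ∉ commutator G → conjugatesOf g = g • (commutator G : Set G)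

/-- A Camina `p`-group: a finite group that is both a Camina group and a `p`-group. -/
structure IsCaminaPGroup (p : ℕ) (G : Type*) [Group G] : Prop where
  finite : Finite G
  isPGroup : IsPGroup p G
  isCamina : IsCaminaGroup G

/-!
Let `K / F` be a quadratic extension of finite fields of odd characteristic. The Heisenberg group
over `K` has class two, and each of its noncentral elements is conjugate to all its translates by
central elements. Extend it by a third layer `F²` in which the commutator of `(a, b) ∈ K²` with
`c ∈ K` is `(T (a c), T (b c))`, for a nonzero linear form `T : K → F`. Over an element lying above
`(a, b)`, commutators with the second layer already fill `F²` unless `a` and `b`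
are linearly dependent over `F`, when they fill only a line of `F²`.

The remaining direction comes from a cocycle on `K²`. In the Heisenberg group `(a, b, c)` commutes
with its multiples `(k a, k b, k c)`, and the cocycle, built from a bilinear form `B` on `K` whose
antisymmetrization `ω` is nondegenerate, contributes `(γ ω (k b, b), ω (k a, a) - ω (k b, b))` to
their commutator. This complements the line above if `b = 0`, and for `a = r b` with `r ∈ F` exactly
when `r ^ 3 - r ≠ γ`. As `x ↦ x ^ 3 - x` is not injective on the finite field `F`, it is not
surjective, so a suitable `γ` exists.
-/

section CaminaPair

open scoped commutatorElement

variable {G : Type*} [Group G] {N : Subgroup G}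

/-- `(G, N)` is a Camina pair if every element of `G` outside `N` is conjugate to all its
translates by `N`. Unlike in the usual definition, `N` need not be normal, proper or nontrivial. -/
def IsCaminaPair (N : Subgroup G) : Prop :=
  ∀ g ∉ N, ∀ u ∈ N, IsConj g (g * u)

lemma inv_mul_mem_commutator_of_isConj {g y : G} (h : IsConj g y) : g⁻¹ * y ∈ commutator G := by
  obtain ⟨k, rfl⟩ := isConj_iff.1 h
  have : g⁻¹ * (k * g * k⁻¹) = ⁅g⁻¹, k⁆ := by rw [commutatorElement_def]; group
  rw [this]
  exact Subgroup.commutator_mem_commutator (Subgroup.mem_top _) (Subgroup.mem_top _)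

lemma IsCaminaPair.le_commutator (hN : IsCaminaPair N) (hne : N ≠ ⊤) : N ≤ commutator G := by
  obtain ⟨g, hg⟩ : ∃ g, g ∉ N := by simpa [Subgroup.eq_top_iff'] using hne
  intro u hu
  simpa using inv_mul_mem_commutator_of_isConj (hN g hg u hu)

lemma IsCaminaPair.isCaminaGroup (hG : IsCaminaPair (commutator G)) : IsCaminaGroup G := by
  intro g hg
  ext y
  rw [Set.mem_smul_set_iff_inv_smul_mem, smul_eq_mul, SetLike.mem_coe]
  change IsConj g y ↔ _
  refine ⟨inv_mul_mem_commutator_of_isConj, fun hy => ?_⟩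
  simpa using hG g hg _ hy

-- If `N` contains the center, then `hquot` says that its image in `G ⧸ center G` is a Camina pair.
lemma isCaminaPair_of_center
    (hquot : ∀ g ∉ N, ∀ u ∈ N, ∃ z ∈ Subgroup.center G, IsConj g (g * u * z))
    (hcenter : ∀ g ∉ N, ∀ z ∈ Subgroup.center G, IsConj g (g * z)) : IsCaminaPair N := by
  intro g hg u hu
  obtain ⟨z, hz, hgz⟩ := hquot g hg u hu
  obtain ⟨h, hh⟩ := isConj_iff.1 hgz
  refine (hcenter g hg z⁻¹ (inv_mem hz)).trans (isConj_iff.2 ⟨h, ?_⟩)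
  have hcomm : z⁻¹ * h⁻¹ = h⁻¹ * z⁻¹ := (Subgroup.mem_center_iff.1 (inv_mem hz) h⁻¹).symm
  calc h * (g * z⁻¹) * h⁻¹ = h * g * (z⁻¹ * h⁻¹) := by group
    _ = h * g * h⁻¹ * z⁻¹ := by rw [hcomm]; group
    _ = g * u := by rw [hh]; group

lemma nilpotencyClass_eq_three_of_commutator (hle : ⁅commutator G, ⊤⁆ ≤ Subgroup.center G)
    (hne : ¬ commutator G ≤ Subgroup.center G) :
    Group.IsNilpotent G ∧ Group.nilpotencyClass G = 3 := by
  have hone : Subgroup.lowerCentralSeries (⊤ : Subgroup G) 1 = commutator G :=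
    Subgroup.top_lowerCentralSeries_one
  have hthree : Subgroup.lowerCentralSeries (⊤ : Subgroup G) 3 = ⊥ :=
    Subgroup.lowerCentralSeries_succ_eq_bot _ <| by
      rwa [Subgroup.lowerCentralSeries_succ, hone]
  have hnil : Group.IsNilpotent G := Subgroup.nilpotent_iff_lowerCentralSeries.2 ⟨3, hthree⟩
  refine ⟨hnil, le_antisymm
    (Subgroup.lowerCentralSeries_eq_bot_iff_nilpotencyClass_le.1 hthree) ?_⟩
  by_contra! hlt
  have htwo := Subgroup.lowerCentralSeries_eq_bot_iff_nilpotencyClass_le.2 (Nat.le_of_lt_succ hlt)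
  rw [Subgroup.lowerCentralSeries_succ, hone, Subgroup.commutator_eq_bot_iff_le_centralizer,
    Subgroup.coe_top, Subgroup.centralizer_univ] at htwo
  exact hne htwo

end CaminaPair

section LinearForms

lemma surjective_of_forall_mul_fst_add_mul_snd {F V : Type*} [Field F] [AddCommGroup V]
    [Module F V] {f : V →ₗ[F] F × F}
    (hf : ∀ s t : F, (∀ x, s * (f x).1 + t * (f x).2 = 0) → s = 0 ∧ t = 0) :
    Function.Surjective f := by
  rw [← LinearMap.dualMap_injective_iff, injective_iff_map_eq_zero]
  intro φ hφ
  have hφ_apply (z : F × F) : φ (1, 0) * z.1 + φ (0, 1) * z.2 = φ z := by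
    rw [mul_comm, mul_comm _ z.2, ← smul_eq_mul, ← smul_eq_mul, ← map_smul, ← map_smul, ← map_add]
    simp
  obtain ⟨hs, ht⟩ := hf (φ (1, 0)) (φ (0, 1)) fun x =>
    (hφ_apply (f x)).trans (LinearMap.congr_fun hφ x)
  ext <;> simp [hs, ht]

lemma eq_zero_of_forall_apply_mul_eq_zero {F K M : Type*} [Semiring F] [DivisionRing K]
    [Module F K] [AddCommMonoid M] [Module F M] {T : K →ₗ[F] M} (hT : T ≠ 0) {a : K}
    (h : ∀ c, T (c * a) = 0) : a = 0 := by
  by_contra ha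
  refine hT (LinearMap.ext fun y => ?_)
  simpa [ha] using h (y * a⁻¹)

lemma exists_mul_sub_mul_eq {K : Type*} [Field K] {a b : K} (hab : ¬(a = 0 ∧ b = 0)) (w : K) :
    ∃ a' b', b' * a - a' * b = w := by
  by_cases ha : a = 0
  · have hb : b ≠ 0 := fun hb => hab ⟨ha, hb⟩
    exact ⟨-w / b, 0, by field_simp; ring⟩
  · exact ⟨0, w / a, by field_simp; ring⟩

lemma exists_forall_pow_three_sub_ne (F : Type*) [Ring F] [Nontrivial F] [Finite F] :
    ∃ γ : F, ∀ r, r ^ 3 - r ≠ γ := by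
  by_contra! hsurj
  have hinj : Function.Injective fun r : F => r ^ 3 - r := Finite.injective_iff_surjective.2 hsurj
  exact zero_ne_one (hinj (a₁ := 0) (a₂ := 1) (by simp))

lemma exists_separatingRight_sub_flip {F V : Type*} [Field F] [AddCommGroup V] [Module F V]
    (hV : Module.finrank F V = 2) : ∃ B : V →ₗ[F] V →ₗ[F] F, (B - B.flip).SeparatingRight := by
  have : FiniteDimensional F V := .of_finrank_pos (by omega)
  let φ : V ≃ₗ[F] F × F := LinearEquiv.ofFinrankEq _ _ (by simp [hV])
  refine ⟨(LinearMap.mul F F).compl₁₂ (LinearMap.fst F F F ∘ₗ φ.toLinearMap)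
    (LinearMap.snd F F F ∘ₗ φ.toLinearMap), fun y hy => φ.map_eq_zero_iff.1 (Prod.ext ?_ ?_)⟩
  · simpa using hy (φ.symm (0, 1))
  · simpa using hy (φ.symm (1, 0))

end LinearForms

section CommutatorMap

variable {F K : Type*} [Field F] [Field K] [Algebra F K] {T : K →ₗ[F] F} {ω : K →ₗ[F] K →ₗ[F] F}
  {γ : F}

variable (T ω γ) in
/-- For an element `g` of `TwistedHeisenberg T B γ` with first coordinates `a`, `b`, and for
`ω = B - B.flip`, this maps `(c, k)` to the central coordinates of the commutator of
`(k * g.a, k * g.b, c + k * g.c)` with `g`. -/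
def commutatorMap (a b : K) : K × K →ₗ[F] F × F :=
  let diag (α : K) : K →ₗ[F] F := ω.flip α ∘ₗ LinearMap.mulRight F α
  ((T ∘ₗ LinearMap.mulRight F a).coprod (γ • diag b)).prod
    ((T ∘ₗ LinearMap.mulRight F b).coprod (diag a - diag b))

lemma commutatorMap_apply (a b c k : K) : commutatorMap T ω γ a b (c, k) =
    (T (c * a) + γ * ω (k * b) b, T (c * b) + (ω (k * a) a - ω (k * b) b)) := rfl

lemma eq_zero_of_forall_apply_mul_self_eq_zero (hω : ω.SeparatingRight) {a : K}
    (h : ∀ k, ω (k * a) a = 0) : a = 0 := by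
  by_contra ha
  exact ha (hω a fun x => by simpa [ha] using h (x * a⁻¹))

lemma eq_zero_of_forall_commutatorMap_eq_zero (hT : T ≠ 0) (hω : ω.SeparatingRight)
    (hγ : ∀ r : F, r ^ 3 - r ≠ γ) {a b : K} (hab : ¬(a = 0 ∧ b = 0)) {s t : F}
    (hst : ∀ x, s * (commutatorMap T ω γ a b x).1 + t * (commutatorMap T ω γ a b x).2 = 0) :
    s = 0 ∧ t = 0 := by
  have hline : s • a + t • b = 0 := eq_zero_of_forall_apply_mul_eq_zero hT fun c => by
    simpa [commutatorMap_apply, mul_add] using hst (c, 0)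
  have htwist (k : K) : s * (γ * ω (k * b) b) + t * (ω (k * a) a - ω (k * b) b) = 0 := by
    simpa [commutatorMap_apply] using hst (0, k)
  by_cases hs : s = 0
  · subst hs
    refine ⟨rfl, by_contra fun ht => hab ?_⟩
    have hb : b = 0 := by simpa [ht] using hline
    exact ⟨eq_zero_of_forall_apply_mul_self_eq_zero hω fun k => by simpa [hb, ht] using htwist k,
      hb⟩
  · exfalso
    obtain ⟨r, rfl⟩ : ∃ r, t = -(s * r) := ⟨-(t / s), by field_simp⟩
    obtain rfl : a = r • b := by
      rw [neg_smul, mul_smul, ← sub_eq_add_neg, sub_eq_zero] at hline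
      exact smul_right_injective K hs hline
    have hb : b = 0 := eq_zero_of_forall_apply_mul_self_eq_zero hω fun k => by
      have hk := htwist k
      simp only [mul_smul_comm, map_smul, LinearMap.smul_apply, smul_eq_mul] at hk
      have hfactor : s * (γ - (r ^ 3 - r)) * ω (k * b) b = 0 := by linear_combination hk
      simpa [hs, sub_eq_zero, (hγ r).symm] using hfactor
    exact hab ⟨by rw [hb, smul_zero], hb⟩

lemma commutatorMap_surjective (hT : T ≠ 0) (hω : ω.SeparatingRight)
    (hγ : ∀ r : F, r ^ 3 - r ≠ γ) {a b : K} (hab : ¬(a = 0 ∧ b = 0)) :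
    Function.Surjective (commutatorMap T ω γ a b) :=
  surjective_of_forall_mul_fst_add_mul_snd fun _ _ =>
    eq_zero_of_forall_commutatorMap_eq_zero hT hω hγ hab

end CommutatorMap

/-- The group on `K × K × K × F × F` obtained from the Heisenberg group over `K`, with coordinates
`a`, `b`, `c`, by a central extension with kernel `F × F`, with coordinates `d`, `e`. The linear
form `T` defines the commutators of `c` with `a` and `b`, while `B` and `γ` define a cocycle in `a`
and `b` alone. The coordinate `c` is symmetrized, so that in it the commutator of `x` and `y` is
`2 * (x.b * y.a - x.a * y.b)`. -/
@[ext]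
structure TwistedHeisenberg {F K : Type*} [CommRing F] [CommRing K] [Algebra F K]
    (T : K →ₗ[F] F) (B : K →ₗ[F] K →ₗ[F] F) (γ : F) where
  a : K
  b : K
  c : K
  d : F
  e : F

namespace TwistedHeisenberg

section CommRing

variable {F K : Type*} [CommRing F] [CommRing K] [Algebra F K] {T : K →ₗ[F] F}
  {B : K →ₗ[F] K →ₗ[F] F} {γ : F}

instance : Mul (TwistedHeisenberg T B γ) where
  mul x y :=
    { a := x.a + y.a
      b := x.b + y.b
      c := x.c + y.c + (x.b * y.a - x.a * y.b)
      d := x.d + y.d + T (y.a * (x.c + x.b * (x.a + y.a))) + γ * B x.b y.b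
      e := x.e + y.e + T (y.b * (x.c - x.a * (x.b + y.b))) + (B x.a y.a - B x.b y.b) }

instance : One (TwistedHeisenberg T B γ) where
  one := ⟨0, 0, 0, 0, 0⟩

instance : Inv (TwistedHeisenberg T B γ) where
  inv x :=
    { a := -x.a
      b := -x.b
      c := -x.c
      d := -x.d + T (x.a * x.c) + γ * B x.b x.b
      e := -x.e + T (x.b * x.c) + (B x.a x.a - B x.b x.b) }

variable (x y : TwistedHeisenberg T B γ)

@[simp] lemma mul_a : (x * y).a = x.a + y.a := rfl

@[simp] lemma mul_b : (x * y).b = x.b + y.b := rfl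

@[simp] lemma mul_c : (x * y).c = x.c + y.c + (x.b * y.a - x.a * y.b) := rfl

@[simp] lemma mul_d :
    (x * y).d = x.d + y.d + T (y.a * (x.c + x.b * (x.a + y.a))) + γ * B x.b y.b := rfl

@[simp] lemma mul_e : (x * y).e =
    x.e + y.e + T (y.b * (x.c - x.a * (x.b + y.b))) + (B x.a y.a - B x.b y.b) := rfl

@[simp] lemma one_a : (1 : TwistedHeisenberg T B γ).a = 0 := rfl

@[simp] lemma one_b : (1 : TwistedHeisenberg T B γ).b = 0 := rfl

@[simp] lemma one_c : (1 : TwistedHeisenberg T B γ).c = 0 := rfl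

@[simp] lemma one_d : (1 : TwistedHeisenberg T B γ).d = 0 := rfl

@[simp] lemma one_e : (1 : TwistedHeisenberg T B γ).e = 0 := rfl

@[simp] lemma inv_a : x⁻¹.a = -x.a := rfl

@[simp] lemma inv_b : x⁻¹.b = -x.b := rfl

@[simp] lemma inv_c : x⁻¹.c = -x.c := rfl

@[simp] lemma inv_d : x⁻¹.d = -x.d + T (x.a * x.c) + γ * B x.b x.b := rfl

@[simp] lemma inv_e : x⁻¹.e = -x.e + T (x.b * x.c) + (B x.a x.a - B x.b x.b) := rfl

protected lemma mul_assoc (z : TwistedHeisenberg T B γ) : x * y * z = x * (y * z) := by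
  ext
  · simp only [mul_a, add_assoc]
  · simp only [mul_b, add_assoc]
  · simp only [mul_a, mul_b, mul_c]
    ring
  · have hT : T (y.a * (x.c + x.b * (x.a + y.a))) + T (z.a * ((x * y).c + (x * y).b *
        ((x * y).a + z.a))) = T (z.a * (y.c + y.b * (y.a + z.a))) +
        T ((y * z).a * (x.c + x.b * (x.a + (y * z).a))) := by
      simp only [← map_add, mul_a, mul_b, mul_c]
      congr 1
      ring
    rw [mul_d, mul_d, mul_d x, mul_d y]
    simp only [mul_b, map_add, LinearMap.add_apply]
    linear_combination hT
  · have hT : T (y.b * (x.c - x.a * (x.b + y.b))) + T (z.b * ((x * y).c - (x * y).a *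
        ((x * y).b + z.b))) = T (z.b * (y.c - y.a * (y.b + z.b))) +
        T ((y * z).b * (x.c - x.a * (x.b + (y * z).b))) := by
      simp only [← map_add, mul_a, mul_b, mul_c]
      congr 1
      ring
    rw [mul_e, mul_e, mul_e x, mul_e y]
    simp only [mul_a, mul_b, map_add, LinearMap.add_apply]
    linear_combination hT

instance : Group (TwistedHeisenberg T B γ) :=
  Group.ofLeftAxioms TwistedHeisenberg.mul_assoc
    (fun x => by ext <;> simp)
    (fun x => by
      ext
      · simp
      · simp
      · simp [mul_comm]
      · simp only [mul_d, inv_a, inv_b, inv_c, inv_d, one_d, neg_add_cancel, mul_zero, add_zero,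
          mul_neg, map_neg, LinearMap.neg_apply]
        ring
      · simp only [mul_e, inv_a, inv_b, inv_c, inv_e, one_e, neg_add_cancel, mul_zero, sub_zero,
          mul_neg, map_neg, LinearMap.neg_apply]
        ring)

variable (T B γ) in
/-- The projection to the coordinates `a` and `b`. Its kernel is the second layer of the group,
which turns out to be the commutator subgroup. -/
def toProd : TwistedHeisenberg T B γ →* Multiplicative (K × K) where
  toFun x := Multiplicative.ofAdd (x.a, x.b)
  map_one' := rfl
  map_mul' _ _ := rfl

variable {x} in
lemma mem_ker_toProd : x ∈ (toProd T B γ).ker ↔ x.a = 0 ∧ x.b = 0 := by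
  rw [MonoidHom.mem_ker]
  exact Prod.ext_iff

lemma ker_toProd_ne_top [Nontrivial K] : (toProd T B γ).ker ≠ ⊤ := fun h =>
  one_ne_zero (mem_ker_toProd.1 (h ▸ Subgroup.mem_top (⟨1, 0, 0, 0, 0⟩ :
    TwistedHeisenberg T B γ))).1

lemma commutator_eq_ker_toProd [Nontrivial K] (hN : IsCaminaPair (toProd T B γ).ker) :
    commutator (TwistedHeisenberg T B γ) = (toProd T B γ).ker :=
  le_antisymm (Abelianization.commutator_subset_ker _) (hN.le_commutator ker_toProd_ne_top)

variable (T B γ) in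
/-- The coordinates of `TwistedHeisenberg T B γ` as a bijection onto a product. -/
def equivProd : TwistedHeisenberg T B γ ≃ K × K × K × F × F where
  toFun x := (x.a, x.b, x.c, x.d, x.e)
  invFun x := ⟨x.1, x.2.1, x.2.2.1, x.2.2.2.1, x.2.2.2.2⟩
  left_inv _ := rfl
  right_inv _ := rfl

instance [Finite F] [Finite K] : Finite (TwistedHeisenberg T B γ) :=
  .of_equiv _ (equivProd T B γ).symm

lemma natCard_eq : Nat.card (TwistedHeisenberg T B γ) = Nat.card K ^ 3 * Nat.card F ^ 2 := by
  rw [Nat.card_congr (equivProd T B γ)]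
  simp only [Nat.card_prod]
  ring

end CommRing

section Field

variable {F K : Type*} [Field F] [Field K] [Algebra F K] {T : K →ₗ[F] F}
  {B : K →ₗ[F] K →ₗ[F] F} {γ : F}

lemma centralizer_ker_toProd (hT : T ≠ 0) :
    Subgroup.centralizer ((toProd T B γ).ker : Set (TwistedHeisenberg T B γ))
      = (toProd T B γ).ker := by
  ext g
  rw [Subgroup.mem_centralizer_iff, mem_ker_toProd]
  constructor
  · intro hg
    have hcomm (c : K) : ⟨0, 0, c, 0, 0⟩ * g = g * ⟨0, 0, c, 0, 0⟩ :=
      hg _ (mem_ker_toProd.2 ⟨rfl, rfl⟩)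
    exact ⟨eq_zero_of_forall_apply_mul_eq_zero hT fun c => by
        simpa [mul_comm] using congrArg TwistedHeisenberg.d (hcomm c),
      eq_zero_of_forall_apply_mul_eq_zero hT fun c => by
        simpa [mul_comm] using congrArg TwistedHeisenberg.e (hcomm c)⟩
  · rintro ⟨ha, hb⟩ u hu
    obtain ⟨hua, hub⟩ := mem_ker_toProd.1 hu
    ext <;> simp [ha, hb, hua, hub, add_comm]

lemma mem_center_iff (hT : T ≠ 0) {z : TwistedHeisenberg T B γ} :
    z ∈ Subgroup.center (TwistedHeisenberg T B γ) ↔ z.a = 0 ∧ z.b = 0 ∧ z.c = 0 := by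
  constructor
  · intro hz
    obtain ⟨ha, hb⟩ : z.a = 0 ∧ z.b = 0 := by
      rw [← mem_ker_toProd, ← centralizer_ker_toProd hT]
      exact Subgroup.center_le_centralizer _ hz
    refine ⟨ha, hb, eq_zero_of_forall_apply_mul_eq_zero hT fun a => ?_⟩
    simpa [ha, hb] using congrArg TwistedHeisenberg.d
      (Subgroup.mem_center_iff.1 hz ⟨a, 0, 0, 0, 0⟩).symm
  · rintro ⟨ha, hb, hc⟩
    rw [Subgroup.mem_center_iff]
    intro g
    ext <;> simp [ha, hb, hc, add_comm]

lemma commutator_ker_toProd_top_le_center (hT : T ≠ 0) :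
    ⁅(toProd T B γ).ker, ⊤⁆ ≤ Subgroup.center (TwistedHeisenberg T B γ) := by
  refine Subgroup.commutator_le.2 fun x hx y _ => (mem_center_iff hT).2 ?_
  obtain ⟨ha, hb⟩ := mem_ker_toProd.1 hx
  simp [commutatorElement_def, ha, hb, mul_comm]

lemma not_ker_toProd_le_center (hT : T ≠ 0) :
    ¬ (toProd T B γ).ker ≤ Subgroup.center (TwistedHeisenberg T B γ) := fun hle =>
  ker_toProd_ne_top ((centralizer_ker_toProd hT).symm.trans
    (Subgroup.centralizer_eq_top_iff_subset.2 hle))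

lemma exists_mem_center_isConj_mul_mul (h2 : (2 : K) ≠ 0) (hT : T ≠ 0)
    {g u : TwistedHeisenberg T B γ} (hg : g ∉ (toProd T B γ).ker) (hu : u ∈ (toProd T B γ).ker) :
    ∃ z ∈ Subgroup.center (TwistedHeisenberg T B γ), IsConj g (g * u * z) := by
  obtain ⟨hua, hub⟩ := mem_ker_toProd.1 hu
  obtain ⟨a', b', hw⟩ := exists_mul_sub_mul_eq (mem_ker_toProd.not.1 hg) (u.c / 2)
  rw [eq_div_iff h2] at hw
  let h : TwistedHeisenberg T B γ := ⟨a', b', 0, 0, 0⟩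
  refine ⟨(g * u)⁻¹ * (h * g * h⁻¹), (mem_center_iff hT).2 ?_, isConj_iff.2 ⟨h, by group⟩⟩
  refine ⟨by simp [h, hua], by simp [h, hub], ?_⟩
  simp only [h, mul_a, mul_b, mul_c, inv_a, inv_b, inv_c, hua, hub]
  linear_combination hw

lemma isConj_mul_of_mem_center (hT : T ≠ 0) (hB : (B - B.flip).SeparatingRight)
    (hγ : ∀ r : F, r ^ 3 - r ≠ γ) {g z : TwistedHeisenberg T B γ} (hg : g ∉ (toProd T B γ).ker)
    (hz : z ∈ Subgroup.center (TwistedHeisenberg T B γ)) : IsConj g (g * z) := by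
  obtain ⟨hza, hzb, hzc⟩ := (mem_center_iff hT).1 hz
  obtain ⟨⟨c, k⟩, hck⟩ :=
    commutatorMap_surjective hT hB hγ (mem_ker_toProd.not.1 hg) (z.d, z.e)
  simp only [commutatorMap_apply, Prod.mk.injEq, LinearMap.sub_apply, LinearMap.flip_apply] at hck
  obtain ⟨hd, he⟩ := hck
  let h : TwistedHeisenberg T B γ := ⟨k * g.a, k * g.b, c + k * g.c, 0, 0⟩
  have hTd : T (g.a * (h.c + h.b * (h.a + g.a)))
      = T (c * g.a) + T (h.a * (g.c + g.b * (g.a + h.a))) := by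
    rw [← map_add]
    congr 1
    ring
  have hTe : T (g.b * (h.c - h.a * (h.b + g.b)))
      = T (c * g.b) + T (h.b * (g.c - g.a * (g.b + h.b))) := by
    rw [← map_add]
    congr 1
    ring
  refine isConj_iff.2 ⟨h, mul_inv_eq_of_eq_mul ?_⟩
  ext
  · simp [hza, add_comm]
  · simp [hzb, add_comm]
  · simp only [h, mul_a, mul_b, mul_c, hza, hzb, hzc]
    ring
  · rw [mul_d, mul_d, mul_d, hTd]
    simp only [mul_a, mul_b, mul_c, hza, hzb, hzc, zero_mul, mul_zero, map_zero, add_zero,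
      sub_zero]
    linear_combination hd
  · rw [mul_e, mul_e, mul_e, hTe]
    simp only [mul_a, mul_b, mul_c, hza, hzb, hzc, zero_mul, mul_zero, map_zero, add_zero,
      sub_zero]
    linear_combination he

lemma isCaminaPair_ker_toProd (h2 : (2 : K) ≠ 0) (hT : T ≠ 0)
    (hB : (B - B.flip).SeparatingRight) (hγ : ∀ r : F, r ^ 3 - r ≠ γ) :
    IsCaminaPair (toProd T B γ).ker :=
  isCaminaPair_of_center (fun _ hg _ => exists_mem_center_isConj_mul_mul h2 hT hg)
    (fun _ hg _ => isConj_mul_of_mem_center hT hB hγ hg)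

end Field

end TwistedHeisenberg

theorem mainTheorem5 (p : ℕ) (hp : p.Prime) (hodd : Odd p) :
    ∃ (G : Type) (_ : Group G), IsCaminaPGroup p G ∧
      (Group.IsNilpotent G ∧ Group.nilpotencyClass G = 3) ∧
      Subgroup.centralizer (commutator G : Set G) = commutator G := by
  have : Fact p.Prime := ⟨hp⟩
  let F := ZMod p
  let K := GaloisField p 2
  have h2 : (2 : K) ≠ 0 := Ring.two_ne_zero <| by
    rw [ringChar.eq K p]
    exact hodd.ne_two_of_dvd_nat dvd_rfl
  have hT : Algebra.trace F K ≠ 0 := Algebra.trace_ne_zero F K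
  obtain ⟨B, hB⟩ := exists_separatingRight_sub_flip (GaloisField.finrank p two_ne_zero)
  obtain ⟨γ, hγ⟩ := exists_forall_pow_three_sub_ne F
  let G := TwistedHeisenberg (Algebra.trace F K) B γ
  have hpair := TwistedHeisenberg.isCaminaPair_ker_toProd h2 hT hB hγ
  have hG' := TwistedHeisenberg.commutator_eq_ker_toProd hpair
  have hcard : Nat.card G = p ^ 8 := by
    rw [TwistedHeisenberg.natCard_eq, GaloisField.card p 2 two_ne_zero, Nat.card_zmod]
    ring
  refine ⟨G, inferInstance, ⟨inferInstance, .of_card hcard, (hG' ▸ hpair).isCaminaGroup⟩,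
    nilpotencyClass_eq_three_of_commutator ?_ ?_, ?_⟩ <;> rw [hG']
  · exact TwistedHeisenberg.commutator_ker_toProd_top_le_center hT
  · exact TwistedHeisenberg.not_ker_toProd_le_center hT
  · exact TwistedHeisenberg.centralizer_ker_toProd hT
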